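/- **Setting.** Let $\mathbb{T}$ be the countable set of finite unlabeled rooted trees (finite rooted trees up to root-preserving graph isomorphism), and let $\mathbb{T}_* = \mathbb{T}\sqcup\{*\}$, where $*$ is an adjoined point. Both carry the discrete topology, and $\mathbb{T}^\infty$ and $\mathbb{T}_*^\infty$ carry the product topologies. Let $\mathbf{t}\in\mathbb{T}$ have root $\rho$, let $v$ be a vertex of $\mathbf{t}$ at distance $h$ from $\rho$, and let $(v=v_0,v_1,\dots,v_h=\rho)$ be the path from $v$ to $\rho$. Let $t_0$ be the subtree, rooted at $v_0$, consisting of all vertices whose path to the root passes through $v_0$; for $1\le k\le h$ let $t_k$ be the subtree, rooted at $v_k$, consisting of all vertices whose path to the root passes through $v_k$ but not through $v_{k-1}$. Let $\Phi(\mathbf{t},\cdot)$ be the probability measure on $\mathbb{T}_*^\infty$ that places mass $1/\#\mathbf{t}$ at each of the sequences $(t_0,t_1,\dots,t_h,*,*,\dots)$ as $v$ ranges over the $\#\mathbf{t}$ vertices of $\mathbf{t}$ (masses of equal sequences are added). A sequence $(\mathcal{T}_n)$ of random elements of $\mathbb{T}$ (possibly defined on different probability spaces) *converges in the probability fringe sense*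 to a $\mathbb{T}^\infty$-valued random variable $\mathcal{T}$ (a random sin-tree) if the random probability measures $\Phi(\mathcal{T}_n,\cdot)$ converge in distribution to the deterministic measure given by the law of $\mathcal{T}$ (regarded as a probability measure on $\mathbb{T}_*^\infty$), for the topology of weak convergence of probability measures on $\mathbb{T}_*^\infty$. The *spectral distribution* $F_n$ of $\mathcal{T}_n$ is the random probability measure on $\mathbb{R}$ that places mass $1/\#\mathcal{T}_n$ at each eigenvalue of the adjacency matrix of $\mathcal{T}_n$, counted with multiplicity. **Theorem.** Suppose that $(\mathcal{T}_n)$ converges in the probability fringe sense to a random sin-tree $\mathcal{T}$. Then there is a deterministic probability measure $F$ on $\mathbb{R}$ such that $F_n$ converges in distribution to $F$, for the topology of weak convergence of probability measures on $\mathbb{R}$. Moreover, for every $\gamma\in\mathbb{R}$ there is a constant $c_\gamma$ such that $F_n(\{\gamma\})$ converges in distribution to $c_\gamma$ as $n\to\infty$, and every deterministic probability measure $F$ on $\mathbb{R}$ to which $F_n$ converges in this sense satisfies $F(\{\gamma\})\ge c_\gamma$. -/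

import Mathlib

open MeasureTheory Filter Topology
open scoped ENNReal

noncomputable section

namespace RandomTree

/-! ### Finite rooted trees, labeled and unlabeled -/

/-- A finite labeled rooted tree: a tree (connected acyclic graph) on the vertex set
`{0, …, card - 1}` with a distinguished vertex, the root. A tree has at least one vertex. -/
structure LabeledTree where
  card : ℕ
  graph : SimpleGraph (Fin card)
  isTree : graph.IsTree
  root : Fin card

/-- Two rooted trees are the same up to labeling if there is a graph isomorphism between them
that preserves the root. -/
instance LabeledTree.setoid : Setoid LabeledTree where
  r s t := ∃ e : s.graph ≃g t.graph, e s.root = t.root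
  iseqv :=
    { refl := fun _ => ⟨SimpleGraph.Iso.refl, rfl⟩
      symm := by
        rintro s t ⟨e, he⟩
        exact ⟨e.symm, by rw [← he]; exact e.symm_apply_apply _⟩
      trans := by
        rintro s t u ⟨e, he⟩ ⟨f, hf⟩
        exact ⟨e.trans f, by rw [← hf, ← he]; rfl⟩ }

/-- The space `𝕋` of finite unlabeled rooted trees: root-preserving isomorphism classes. -/
def UnlabeledTree : Type := Quotient LabeledTree.setoid

/-- The isomorphism class of a rooted tree on an arbitrary finite vertex set. -/
def UnlabeledTree.of {V : Type*} [Fintype V] (G : SimpleGraph V) (hG : G.IsTree) (r : V) :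
    UnlabeledTree :=
  Quotient.mk LabeledTree.setoid
    { card := Fintype.card V
      graph := G.comap (Fintype.equivFin V).symm
      isTree := (SimpleGraph.Iso.comap (Fintype.equivFin V).symm G).isTree_iff.mpr hG
      root := Fintype.equivFin V r }

/-- A labeled representative of an unlabeled tree. It is only used to define quantities which
do not depend on the choice of the representative. -/
def UnlabeledTree.rep (t : UnlabeledTree) : LabeledTree := Quotient.out t

instance : Countable LabeledTree := by
  have : Function.Injective (fun t : LabeledTree =>
      (⟨t.card, t.graph, t.root⟩ : Σ n : ℕ, SimpleGraph (Fin n) × Fin n)) := by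
    rintro ⟨n, G, hG, r⟩ ⟨m, H, hH, s⟩ h
    simp only [Sigma.mk.injEq] at h
    obtain ⟨rfl, h⟩ := h
    simp only [heq_eq_eq, Prod.mk.injEq] at h
    obtain ⟨rfl, rfl⟩ := h
    rfl
  exact this.countable

instance : Countable UnlabeledTree :=
  inferInstanceAs (Countable (Quotient LabeledTree.setoid))

/-- `𝕋` carries the discrete topology. -/
instance : TopologicalSpace UnlabeledTree := ⊥
instance : DiscreteTopology UnlabeledTree := ⟨rfl⟩
instance : MeasurableSpace UnlabeledTree := ⊤
instance : DiscreteMeasurableSpace UnlabeledTree := ⟨fun _ => trivial⟩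

/-- The space `𝕋_* = 𝕋 ⊔ {*}`, where `none` is the adjoined point `*`, with the discrete
topology. The countable product `ℕ → 𝕋_*` then carries the product topology and the product
`σ`-algebra (which is its Borel `σ`-algebra) through the instances for function types. -/
abbrev TreeStar : Type := Option UnlabeledTree

instance : TopologicalSpace TreeStar := ⊥
instance : DiscreteTopology TreeStar := ⟨rfl⟩
instance : MeasurableSpace TreeStar := ⊤
instance : DiscreteMeasurableSpace TreeStar := ⟨fun _ => trivial⟩

/-! ### Fringe subtrees -/

section Fringe

variable {V : Type*} (G : SimpleGraph V)

/-- `Below G r v w`: the vertex `w` is below `v` in the tree `G` with root `r`, that is, the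
path from `w` to the root passes through `v`. (In a tree this path is unique.) -/
def Below (r v w : V) : Prop := ∃ p : G.Walk w r, p.IsPath ∧ v ∈ p.support

variable {G}

theorem below_self (hG : G.IsTree) (r v : V) : Below G r v v := by
  obtain ⟨p, hp, -⟩ := hG.existsUnique_path v r
  exact ⟨p, hp, p.start_mem_support⟩

/-- If the path from each vertex of `s` to `v` stays in `s`, then `s` spans a subtree. -/
theorem isTree_induce (hG : G.IsTree) (s : Set V) (v : V) (hv : v ∈ s)
    (h : ∀ w ∈ s, ∃ p : G.Walk w v, ∀ u ∈ p.support, u ∈ s) : (G.induce s).IsTree where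
  isAcyclic := hG.isAcyclic.induce s
  connected := by
    have : Nonempty s := ⟨⟨v, hv⟩⟩
    have key : ∀ w : s, (G.induce s).Reachable w ⟨v, hv⟩ := by
      rintro ⟨w, hw⟩
      obtain ⟨p, hp⟩ := h w hw
      exact ⟨p.induce s hp⟩
    exact ⟨fun a b => (key a).trans (key b).symm⟩

/-- The vertices on the path from `w` up to `v` are below `v`, and each vertex above one of
them is above `w`. -/
theorem exists_walk_below {r v w : V} (h : Below G r v w) :
    ∃ p : G.Walk w v, ∀ u ∈ p.support,
      Below G r v u ∧ (G.IsTree → ∀ x, Below G r x u → Below G r x w) := by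
  classical
  obtain ⟨p, hp, hv⟩ := h
  refine ⟨p.takeUntil v hv, fun u hu => ?_⟩
  have hup : u ∈ p.support := p.support_takeUntil_subset_support hv hu
  have hdrop : (p.dropUntil u hup).IsPath := hp.dropUntil hup
  refine ⟨⟨p.dropUntil u hup, hdrop, ?_⟩, ?_⟩
  · by_cases huv : u = v
    · subst huv
      exact SimpleGraph.Walk.start_mem_support _
    · have hvu : v ∉ (p.takeUntil u hup).support := by
        have hx : (p.takeUntil u hup) = (p.takeUntil v hv).takeUntil u hu :=
          (p.takeUntil_takeUntil hv hu).symm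
        rw [hx]
        exact SimpleGraph.Walk.endpoint_notMem_support_takeUntil (hp.takeUntil hv) hu
          (Ne.symm huv)
      have hspec : v ∈ ((p.takeUntil u hup).append (p.dropUntil u hup)).support := by
        rw [p.take_spec hup]; exact hv
      rw [SimpleGraph.Walk.mem_support_append_iff] at hspec
      exact hspec.resolve_left hvu
  · rintro hG x ⟨q, hq, hx⟩
    have : q = p.dropUntil u hup := (hG.existsUnique_path u r).unique hq hdrop
    subst this
    exact ⟨p, hp, p.support_dropUntil_subset_support hup hx⟩

/-- The ancestors `v = v_0, v_1, …, v_h = r` of `v`, listed along the unique path from `v` to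
the root `r` (constantly equal to `r` after index `h`). -/
def ancestor (hG : G.IsTree) (r v : V) (k : ℕ) : V :=
  (hG.existsUnique_path v r).choose.getVert k

/-- The vertex set of the `k`-th fringe subtree `t_k` of the vertex `v`: for `k = 0` all
vertices below `v`, and for `k ≥ 1` all vertices that are below `v_k` but not below
`v_{k-1}`. -/
def fringeSet (hG : G.IsTree) (r v : V) : ℕ → Set V
  | 0 => {w | Below G r v w}
  | k + 1 => {w | Below G r (ancestor hG r v (k + 1)) w ∧ ¬ Below G r (ancestor hG r v k) w}

theorem ancestor_zero (hG : G.IsTree) (r v : V) : ancestor hG r v 0 = v := by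
  simp [ancestor]

theorem ancestor_not_below (hG : G.IsTree) (r v : V) (k : ℕ) (hk : k + 1 ≤ G.dist v r) :
    ¬ Below G r (ancestor hG r v k) (ancestor hG r v (k + 1)) := by
  have hp : (hG.existsUnique_path v r).choose.IsPath := (hG.existsUnique_path v r).choose_spec.1
  have hlen : G.dist v r ≤ (hG.existsUnique_path v r).choose.length := SimpleGraph.dist_le _
  unfold ancestor
  generalize (hG.existsUnique_path v r).choose = p at hp hlen
  rintro ⟨q, hq, hmem⟩
  have hqe : q = p.drop (k + 1) := (hG.existsUnique_path _ r).unique hq (hp.drop _)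
  subst hqe
  rw [SimpleGraph.Walk.mem_support_iff_exists_getVert] at hmem
  obtain ⟨n, hn, hn'⟩ := hmem
  rw [SimpleGraph.Walk.drop_getVert] at hn
  rw [SimpleGraph.Walk.drop_length] at hn'
  have := hp.getVert_injOn (by simp; omega) (by simp; omega) hn
  omega

theorem ancestor_mem_fringeSet (hG : G.IsTree) (r v : V) (k : ℕ) (hk : k ≤ G.dist v r) :
    ancestor hG r v k ∈ fringeSet hG r v k := by
  cases k with
  | zero => rw [ancestor_zero]; exact below_self hG r v
  | succ k => exact ⟨below_self hG r _, ancestor_not_below hG r v k hk⟩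

theorem isTree_fringe (hG : G.IsTree) (r v : V) (k : ℕ) (hk : k ≤ G.dist v r) :
    (G.induce (fringeSet hG r v k)).IsTree := by
  refine isTree_induce hG _ _ (ancestor_mem_fringeSet hG r v k hk) fun w hw => ?_
  cases k with
  | zero =>
    rw [ancestor_zero]
    obtain ⟨p, hp⟩ := exists_walk_below hw
    exact ⟨p, fun u hu => (hp u hu).1⟩
  | succ k =>
    obtain ⟨p, hp⟩ := exists_walk_below hw.1
    exact ⟨p, fun u hu => ⟨(hp u hu).1, fun h => hw.2 ((hp u hu).2 hG _ h)⟩⟩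

open Classical in
/-- The sequence `(t_0, t_1, …, t_h, *, *, …)` of the fringe subtrees of the vertex `v`, where
`h` is the distance of `v` from the root `r`; the tree `t_k` is rooted at `v_k`. -/
def fringeSeq [Fintype V] (hG : G.IsTree) (r v : V) (k : ℕ) : TreeStar :=
  if hk : k ≤ G.dist v r then
    some (UnlabeledTree.of (G.induce (fringeSet hG r v k)) (isTree_fringe hG r v k hk)
      ⟨ancestor hG r v k, ancestor_mem_fringeSet hG r v k hk⟩)
  else none

end Fringe

/-! ### Empirical distributions: the fringe distribution and the spectral distribution -/

/-- The empirical distribution of a nonempty finite family of points: mass `1 / n` at each of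
the `n` points, counted with multiplicity. -/
def empirical {ι α : Type*} [Fintype ι] [Nonempty ι] [MeasurableSpace α] (x : ι → α) :
    ProbabilityMeasure α :=
  ⟨(Fintype.card ι : ℝ≥0∞)⁻¹ • ∑ i, Measure.dirac (x i), ⟨by
    simp only [Measure.smul_apply, Measure.finsetSum_apply, measure_univ, Finset.sum_const,
      Finset.card_univ, nsmul_eq_mul, mul_one, smul_eq_mul]
    exact ENNReal.inv_mul_cancel (by simp) (by simp)⟩⟩

instance (t : LabeledTree) : Nonempty (Fin t.card) := ⟨t.root⟩

/-- The probability measure `Φ(t, ·)` on `𝕋_*^∞`: the distribution of the sequence of fringe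
subtrees of a uniformly chosen vertex of `t`. -/
def fringeDist (t : UnlabeledTree) : ProbabilityMeasure (ℕ → TreeStar) :=
  empirical (fringeSeq t.rep.isTree t.rep.root)

open Classical in
theorem isHermitian_adjMatrix {V : Type*} (G : SimpleGraph V) :
    (G.adjMatrix ℝ).IsHermitian :=
  Matrix.IsHermitian.ext fun i j => by simp [SimpleGraph.adjMatrix_apply, G.adj_comm]

open Classical in
/-- The spectral distribution of the adjacency matrix of `t`: the empirical distribution of its
eigenvalues, counted with multiplicity. -/
def spectralDist (t : UnlabeledTree) : ProbabilityMeasure ℝ :=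
  empirical (isHermitian_adjMatrix t.rep.graph).eigenvalues

/-! ### Convergence -/

/-- Convergence in distribution, as `n → ∞`, of a sequence of random elements `X n` of a
topological space `E` (with its Borel `σ`-algebra), where `X n` is defined on the probability
space `(Ω n, P n)`, to the deterministic element `c` of `E`. -/
def TendstoInDistributionConst {Ω : ℕ → Type*} [∀ n, MeasurableSpace (Ω n)]
    (P : ∀ n, Measure (Ω n)) [∀ n, IsProbabilityMeasure (P n)]
    {E : Type*} [TopologicalSpace E] (X : ∀ n, Ω n → E) (c : E) : Prop :=
  letI : MeasurableSpace E := borel E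
  haveI : BorelSpace E := ⟨rfl⟩
  TendstoInDistribution X atTop (fun _ : Unit => c) P (Measure.dirac ())

/-- The distribution on `𝕋_*^∞` of a `𝕋^∞`-valued random variable (a random sin-tree). -/
def sinTreeLaw {Ω : Type*} [MeasurableSpace Ω] (P : Measure Ω) [IsProbabilityMeasure P]
    (S : Ω → ℕ → UnlabeledTree) (hS : Measurable S) : ProbabilityMeasure (ℕ → TreeStar) :=
  ⟨P.map (fun ω k => some (S ω k)), Measure.isProbabilityMeasure_map
    (measurable_pi_lambda _ fun k =>
      (Measurable.of_discrete (f := fun t : UnlabeledTree => (some t : TreeStar))).comp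
        ((measurable_pi_apply k).comp hS)).aemeasurable⟩

/-- Probability fringe convergence of random finite unlabeled rooted trees `T n` to the random
sin-tree `S`: the random probability measures `Φ(T n, ·)` converge in distribution to the law
of `S`, for the topology of weak convergence of probability measures on `𝕋_*^∞`. -/
def ProbabilityFringeConverges {Ω : ℕ → Type*} [∀ n, MeasurableSpace (Ω n)]
    (P : ∀ n, Measure (Ω n)) [∀ n, IsProbabilityMeasure (P n)] (T : ∀ n, Ω n → UnlabeledTree)
    {Ω' : Type*} [MeasurableSpace Ω'] (P' : Measure Ω') [IsProbabilityMeasure P']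
    (S : Ω' → ℕ → UnlabeledTree) (hS : Measurable S) : Prop :=
  TendstoInDistributionConst P (fun n ω => fringeDist (T n ω)) (sinTreeLaw P' S hS)

end RandomTree

end

noncomputable section

namespace RandomTree

/-! ### Counting eigenvalues -/

/-! Eigenvalue counts of a tree are additive over its fringe subtrees. For a set `s` of reals let
the gain of a rooted tree be its number of eigenvalues in `s` minus that number after deletion of
the root. Deleting the root `v` of the subtree below `v` leaves the disjoint subtrees below its
children, so the gains telescope: summed over all vertices they give the eigenvalue count of the
whole tree (`sum_rootGain`). Hence the spectral mass of `s` is the integral of the gain of `t_0`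
against the fringe distribution (`integral_treeGain_fringeDist`).

The gain is bounded uniformly over all trees: by 1 for a half-line, by Cauchy interlacing
(`eigCount_delete`), and so by 2 for a point. As the tree space is discrete, it is a bounded
continuous function of the fringe sequence, so weak convergence of fringe distributions yields
convergence of the spectral mass of every `Set.Iic x` and every `{γ}`. Dominated convergence shows
that the limiting distribution function tends to 0 and 1 at the two ends, so the spectral
distributions converge weakly; the bound on atoms is the portmanteau inequality for the closed set
`{γ}`.

Randomness enters only formally. Convergence in distribution to a constant is convergence in
probability, and the argument above is a deterministic limit along `comap fringeDist (𝓝 μ)`. -/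

open Classical in
/-- The number of real eigenvalues of `A` in `s`, counted with algebraic multiplicity. -/
def eigCount (s : Set ℝ) {n : Type*} [Finite n] (A : Matrix n n ℝ) : ℕ :=
  letI := Fintype.ofFinite n
  A.charpoly.roots.countP (· ∈ s)

open Classical in
theorem eigCount_def (s : Set ℝ) {n : Type*} [Fintype n] [inst : DecidableEq n]
    (A : Matrix n n ℝ) : eigCount s A = A.charpoly.roots.countP (· ∈ s) := by
  unfold eigCount
  congr!

theorem eigCount_submatrix (s : Set ℝ) {m n : Type*} [Finite m] [Finite n] (e : m ≃ n)
    (A : Matrix n n ℝ) : eigCount s (A.submatrix e e) = eigCount s A := by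
  classical
  have := Fintype.ofFinite m
  have := Fintype.ofFinite n
  rw [eigCount_def, eigCount_def, ← Matrix.charpoly_reindex e.symm A]
  rfl

theorem eigCount_fromBlocks (s : Set ℝ) {m n : Type*} [Finite m] [Finite n]
    (A : Matrix m m ℝ) (D : Matrix n n ℝ) :
    eigCount s (Matrix.fromBlocks A 0 0 D) = eigCount s A + eigCount s D := by
  classical
  have := Fintype.ofFinite m
  have := Fintype.ofFinite n
  rw [eigCount_def, eigCount_def, eigCount_def, Matrix.charpoly_fromBlocks_zero₁₂,
    Polynomial.roots_mul (mul_ne_zero A.charpoly_monic.ne_zero D.charpoly_monic.ne_zero),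
    Multiset.countP_add]

theorem eigCount_of_isEmpty (s : Set ℝ) {n : Type*} [IsEmpty n] (A : Matrix n n ℝ) :
    eigCount s A = 0 := by
  classical
  have := Fintype.ofFinite n
  rw [eigCount_def, Matrix.charpoly, Matrix.det_isEmpty]
  simp

theorem eigCount_disjoint_union {s t : Set ℝ} (h : Disjoint s t) {n : Type*} [Finite n]
    (A : Matrix n n ℝ) : eigCount (s ∪ t) A = eigCount s A + eigCount t A := by
  classical
  have := Fintype.ofFinite n
  simp only [eigCount_def]
  induction A.charpoly.roots using Multiset.induction_on with
  | empty => simp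
  | cons a m ih =>
    simp only [Set.mem_union] at ih ⊢
    simp only [Multiset.countP_cons, ih]
    by_cases h1 : a ∈ s
    · have := h.notMem_of_mem_left h1
      simp [h1, this]; omega
    · simp [h1]; omega

open Classical in
theorem eigCount_eq_card (s : Set ℝ) {n : Type*} [Fintype n] [DecidableEq n] {A : Matrix n n ℝ}
    (hA : A.IsHermitian) :
    eigCount s A = Fintype.card {i // hA.eigenvalues i ∈ s} := by
  rw [eigCount_def, hA.roots_charpoly_eq_eigenvalues, Multiset.countP_map, Fintype.card_subtype]
  rfl

theorem eigCount_univ {n : Type*} [Finite n] {A : Matrix n n ℝ} (hA : A.IsHermitian) :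
    eigCount Set.univ A = Nat.card n := by
  classical
  have := Fintype.ofFinite n
  rw [eigCount_eq_card _ hA]
  simp

theorem exists_bound_eigenvalues {n : Type*} [Finite n] {A : Matrix n n ℝ} (hA : A.IsHermitian) :
    ∃ M : ℝ, (∀ x, M ≤ x → eigCount (Set.Iic x) A = Nat.card n) ∧
      ∀ x, x < -M → eigCount (Set.Iic x) A = 0 := by
  classical
  have := Fintype.ofFinite n
  -- The sum dominates every eigenvalue and, unlike a maximum, also makes sense for an empty index
  -- type, which occurs when the root of a one-vertex tree is deleted.
  refine ⟨∑ i, |hA.eigenvalues i|, fun x hx => ?_, fun x hx => ?_⟩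
  all_goals
    have key (i) : |hA.eigenvalues i| ≤ ∑ i, |hA.eigenvalues i| :=
      Finset.single_le_sum (f := fun i => |hA.eigenvalues i|) (fun _ _ => abs_nonneg _)
        (Finset.mem_univ i)
    rw [eigCount_eq_card _ hA]
  · rw [Nat.card_eq_fintype_card, Fintype.card_subtype, Finset.filter_true_of_mem,
      Finset.card_univ]
    exact fun i _ => (le_abs_self _).trans ((key i).trans hx)
  · rw [Fintype.card_eq_zero_iff]
    refine ⟨fun ⟨i, hi⟩ => ?_⟩
    have := neg_abs_le (hA.eigenvalues i)
    have h2 : hA.eigenvalues i ≤ x := hi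
    linarith [key i]

/-! ### Interlacing -/

open Matrix in
theorem exists_orthogonal_diagonalization {n : Type*} [Fintype n] [DecidableEq n]
    {A : Matrix n n ℝ} (hA : A.IsHermitian) :
    ∃ Q : Matrix n n ℝ, (∀ a : n → ℝ, (Q *ᵥ a) ⬝ᵥ (Q *ᵥ a) = ∑ i, a i ^ 2) ∧
      ∀ a : n → ℝ, (Q *ᵥ a) ⬝ᵥ (A *ᵥ (Q *ᵥ a)) = ∑ i, a i ^ 2 * hA.eigenvalues i := by
  set Q : Matrix n n ℝ := hA.eigenvectorUnitary.1
  have h1 : Qᵀ * Q = 1 := by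
    have := Unitary.coe_star_mul_self hA.eigenvectorUnitary
    rwa [Matrix.star_eq_conjTranspose, Matrix.conjTranspose_eq_transpose_of_trivial] at this
  have h2 : Qᵀ * A * Q = diagonal hA.eigenvalues := by
    have := hA.conjStarAlgAut_star_eigenvectorUnitary
    rw [Unitary.conjStarAlgAut_star_apply, Matrix.star_eq_conjTranspose,
      Matrix.conjTranspose_eq_transpose_of_trivial] at this
    simpa using this
  refine ⟨Q, fun a => ?_, fun a => ?_⟩
  · rw [Matrix.dotProduct_mulVec, Matrix.vecMul_mulVec, h1]
    simp [dotProduct, pow_two]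
  · rw [Matrix.mulVec_mulVec, Matrix.dotProduct_mulVec, Matrix.vecMul_mulVec, ← Matrix.mul_assoc,
      h2]
    simp only [dotProduct, Matrix.vecMul_diagonal]
    exact Finset.sum_congr rfl fun i _ => by ring

/-- In eigenvector coordinates `a`, a Rayleigh quotient is a convex combination of the eigenvalues
whose coordinate is nonzero. -/
theorem weighted_sum_mem {ι : Type*} [Fintype ι] {s : Set ℝ} (hs : Convex ℝ s) {a x : ι → ℝ}
    (hx : ∀ i, a i ≠ 0 → x i ∈ s) (h : 0 < ∑ i, a i ^ 2) :
    (∑ i, a i ^ 2)⁻¹ * ∑ i, a i ^ 2 * x i ∈ s := by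
  classical
  have := hs.centerMass_mem (t := Finset.univ.filter fun i => a i ≠ 0) (w := fun i => a i ^ 2)
    (z := x) (fun i _ => sq_nonneg _) ?_ (fun i hi => hx i (by simpa using hi))
  · rwa [Finset.centerMass, smul_eq_mul, Finset.sum_filter_of_ne, Finset.sum_filter_of_ne] at this
    · intro i _ h h0
      simp [h0] at h
    · simp
  · rw [Finset.sum_filter_of_ne]
    · exact h
    · simp

-- A dimension count. Take the span of eigenvectors of `A` for `s`, and the span of those of the
-- submatrix for `sᶜ`, extended by zero. A nonzero common vector would have its Rayleigh quotient in
-- both convex sets `s` and `sᶜ`, so the spans are independent and their dimensions add up to at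
-- most that of the whole space.
open Matrix in
theorem eigCount_add_eigCount_compl_le {s : Set ℝ} (hs : Convex ℝ s) (hs' : Convex ℝ sᶜ)
    {m n : Type*} [Finite m] [Finite n] {A : Matrix n n ℝ} (hA : A.IsHermitian) {f : m → n}
    (hf : Function.Injective f) :
    eigCount s A + eigCount sᶜ (A.submatrix f f) ≤ Nat.card n := by
  classical
  have := Fintype.ofFinite m
  have := Fintype.ofFinite n
  have hB : (A.submatrix f f).IsHermitian := hA.submatrix f
  rw [eigCount_eq_card _ hA, eigCount_eq_card _ hB, Nat.card_eq_fintype_card]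
  obtain ⟨Q, hQ, hQA⟩ := exists_orthogonal_diagonalization hA
  obtain ⟨R, hR, hRB⟩ := exists_orthogonal_diagonalization hB
  set I := {i // hA.eigenvalues i ∈ s}
  set J := {j // hB.eigenvalues j ∈ sᶜ}
  let eI : (I → ℝ) →ₗ[ℝ] (n → ℝ) := Function.ExtendByZero.linearMap ℝ Subtype.val
  let eJ : (J → ℝ) →ₗ[ℝ] (m → ℝ) := Function.ExtendByZero.linearMap ℝ Subtype.val
  let ef : (m → ℝ) →ₗ[ℝ] (n → ℝ) := Function.ExtendByZero.linearMap ℝ f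
  -- The difference of the two parametrized spans; its injectivity is their independence.
  let Φ : (I → ℝ) × (J → ℝ) →ₗ[ℝ] (n → ℝ) :=
    (Q.mulVecLin ∘ₗ eI).coprod (- (ef ∘ₗ R.mulVecLin ∘ₗ eJ))
  have hef (y : m → ℝ) (j : m) : ef y (f j) = y j := hf.extend_apply y 0 j
  have hef' (y : m → ℝ) (i : n) (hi : i ∉ Set.range f) : ef y i = 0 :=
    Function.extend_apply' (f := f) y (0 : n → ℝ) i hi
  -- Extension by zero is adjoint to restriction along `f`, so the form of `A` on extended vectors
  -- is that of the submatrix.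
  have hsum (y : m → ℝ) (z : n → ℝ) : ef y ⬝ᵥ z = y ⬝ᵥ (z ∘ f) := by
    simp only [dotProduct, Function.comp]
    rw [← Finset.sum_subset (Finset.subset_univ (Finset.univ.map ⟨f, hf⟩)), Finset.sum_map]
    · simp [hef]
    · intro i _ hi
      rw [hef' _ _ (by simpa using hi), zero_mul]
  have hcomp (y : m → ℝ) : (A *ᵥ ef y) ∘ f = A.submatrix f f *ᵥ y := by
    ext j
    simp only [Function.comp, mulVec]
    rw [dotProduct_comm, hsum, dotProduct_comm]
    rfl
  have hinj : Function.Injective Φ := by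
    rw [injective_iff_map_eq_zero]
    rintro ⟨a, b⟩ hab
    have hx : Q *ᵥ eI a = ef (R *ᵥ eJ b) := by
      have : Q *ᵥ eI a + - ef (R *ᵥ eJ b) = 0 := hab
      rwa [← sub_eq_add_neg, sub_eq_zero] at this
    have h1 : ∑ i, eI a i ^ 2 = ∑ j, eJ b j ^ 2 := by
      rw [← hQ, ← hR, hx, hsum]
      congr 1
      ext j
      exact hef _ j
    have h2 : ∑ i, eI a i ^ 2 * hA.eigenvalues i = ∑ j, eJ b j ^ 2 * hB.eigenvalues j := by
      rw [← hQA, ← hRB, hx, hsum, hcomp]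
    have haI (i) (hi : eI a i ≠ 0) : hA.eigenvalues i ∈ s := by
      by_contra hcon
      exact hi (Function.extend_apply' (f := Subtype.val) a (0 : n → ℝ) i
        (by rintro ⟨⟨k, hk⟩, rfl⟩; exact hcon hk))
    have hbJ (j) (hj : eJ b j ≠ 0) : hB.eigenvalues j ∈ sᶜ := by
      by_contra hcon
      exact hj (Function.extend_apply' (f := Subtype.val) b (0 : m → ℝ) j
        (by rintro ⟨⟨k, hk⟩, rfl⟩; exact hcon hk))
    have h0 : ∑ i, eI a i ^ 2 = 0 := by
      by_contra hne
      have hpos : 0 < ∑ i, eI a i ^ 2 :=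
        lt_of_le_of_ne (Finset.sum_nonneg fun i _ => sq_nonneg _) (Ne.symm hne)
      have hm1 := weighted_sum_mem hs haI hpos
      have hm2 := weighted_sum_mem hs' hbJ (h1 ▸ hpos)
      rw [← h1, ← h2] at hm2
      exact hm2 hm1
    have ha : ∀ i, eI a i = 0 := by
      simpa [Finset.sum_eq_zero_iff_of_nonneg, sq_nonneg] using h0
    have hb : ∀ j, eJ b j = 0 := by
      rw [h1] at h0
      simpa [Finset.sum_eq_zero_iff_of_nonneg, sq_nonneg] using h0
    ext i
    · exact (Subtype.val_injective.extend_apply a 0 i).symm.trans (ha i.1)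
    · exact (Subtype.val_injective.extend_apply b 0 i).symm.trans (hb i.1)
  have := LinearMap.finrank_le_finrank_of_injective hinj
  rw [Module.finrank_prod, Module.finrank_fintype_fun_eq_card, Module.finrank_fintype_fun_eq_card,
    Module.finrank_fintype_fun_eq_card] at this
  convert this

/-- Cauchy interlacing: deleting one row and the corresponding column of a symmetric matrix
changes the number of eigenvalues in a half-line by at most one. -/
theorem eigCount_delete {s : Set ℝ} (hs : Convex ℝ s) (hs' : Convex ℝ sᶜ)
    {n : Type*} [Finite n] {A : Matrix n n ℝ} (hA : A.IsHermitian) (r : n) :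
    |(eigCount s A : ℝ) -
      eigCount s (A.submatrix (Subtype.val : {i // i ≠ r} → n) Subtype.val)| ≤ 1 := by
  classical
  have := Fintype.ofFinite n
  set B := A.submatrix (Subtype.val : {i // i ≠ r} → n) Subtype.val
  have hB : B.IsHermitian := hA.submatrix _
  -- The dimension count for `s` and for `sᶜ` gives the two inequalities, since the counts in `s`
  -- and `sᶜ` sum to the size of each matrix.
  have h1 := eigCount_add_eigCount_compl_le hs hs' hA (Subtype.val_injective (p := (· ≠ r)))
  have h2 := eigCount_add_eigCount_compl_le hs' (by rwa [compl_compl]) hA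
    (Subtype.val_injective (p := (· ≠ r)))
  rw [compl_compl] at h2
  change _ + eigCount _ B ≤ _ at h1
  change _ + eigCount _ B ≤ _ at h2
  have h3 := eigCount_disjoint_union (disjoint_compl_right (a := s)) A
  have h4 := eigCount_disjoint_union (disjoint_compl_right (a := s)) B
  rw [Set.union_compl_self, eigCount_univ hA] at h3
  rw [Set.union_compl_self, eigCount_univ hB] at h4
  have h5 : Nat.card n = Nat.card {i // i ≠ r} + 1 := by
    have : 0 < Fintype.card n := Fintype.card_pos_iff.mpr ⟨r⟩
    simp [Nat.card_eq_fintype_card, Fintype.card_subtype_compl]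
    omega
  rw [abs_le]
  constructor
  · have : eigCount s B ≤ eigCount s A + 1 := by omega
    have : (eigCount s B : ℝ) ≤ eigCount s A + 1 := by exact_mod_cast this
    linarith
  · have : eigCount s A ≤ eigCount s B + 1 := by omega
    have : (eigCount s A : ℝ) ≤ eigCount s B + 1 := by exact_mod_cast this
    linarith

/-! ### Adjacency matrices and the removal of the root -/

open Classical in
/-- The real adjacency matrix of a graph. -/
def adj {V : Type*} (G : SimpleGraph V) : Matrix V V ℝ := G.adjMatrix ℝ

theorem isHermitian_adj {V : Type*} (G : SimpleGraph V) : (adj G).IsHermitian :=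
  isHermitian_adjMatrix G

theorem adj_eq_zero {V : Type*} {G : SimpleGraph V} {v w : V} (h : ¬ G.Adj v w) :
    adj G v w = 0 := by
  simp [adj, SimpleGraph.adjMatrix_apply, h]

theorem adj_submatrix_of_iff {V W : Type*} {G : SimpleGraph V} {H : SimpleGraph W} (f : V → W)
    (h : ∀ v w, H.Adj (f v) (f w) ↔ G.Adj v w) : (adj H).submatrix f f = adj G := by
  ext v w
  simp only [adj, Matrix.submatrix_apply, SimpleGraph.adjMatrix_apply]
  by_cases hG : G.Adj v w
  · rw [if_pos hG, if_pos ((h v w).mpr hG)]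
  · rw [if_neg hG, if_neg fun hH => hG ((h v w).mp hH)]

/-- The number of eigenvalues in `s` of the rooted graph `(G, r)`, minus the number of
eigenvalues in `s` of the graph obtained by deleting the root. -/
def rootGain (s : Set ℝ) {V : Type*} [Finite V] (G : SimpleGraph V) (r : V) : ℝ :=
  eigCount s (adj G) -
    eigCount s ((adj G).submatrix (Subtype.val : {v // v ≠ r} → V) Subtype.val)

theorem rootGain_congr (s : Set ℝ) {V W : Type*} [Finite V] [Finite W] {G : SimpleGraph V}
    {H : SimpleGraph W} {r : V} {q : W} (e : G ≃g H) (he : e r = q) :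
    rootGain s G r = rootGain s H q := by
  have h1 : (adj H).submatrix e.toEquiv e.toEquiv = adj G :=
    adj_submatrix_of_iff _ fun v w => e.map_adj_iff
  let e' : {v // v ≠ r} ≃ {w // w ≠ q} := e.toEquiv.subtypeEquiv fun v => by
    rw [← he]
    exact e.injective.ne_iff.symm
  unfold rootGain
  rw [← eigCount_submatrix s e.toEquiv (adj H), h1, ← eigCount_submatrix s e', ← h1]
  rfl

theorem abs_rootGain_le_one {s : Set ℝ} (hs : Convex ℝ s) (hs' : Convex ℝ sᶜ) {V : Type*}
    [Finite V] (G : SimpleGraph V) (r : V) : |rootGain s G r| ≤ 1 :=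
  eigCount_delete hs hs' (isHermitian_adj G) r

theorem rootGain_disjoint_union {s t : Set ℝ} (h : Disjoint s t) {V : Type*} [Finite V]
    (G : SimpleGraph V) (r : V) : rootGain (s ∪ t) G r = rootGain s G r + rootGain t G r := by
  unfold rootGain
  rw [eigCount_disjoint_union h, eigCount_disjoint_union h]
  push_cast
  ring

/-! ### Decomposition of the spectrum along the fringe subtrees -/

section Telescope

variable {V : Type*} {G : SimpleGraph V}

/-- The number of eigenvalues in `s` of the subgraph of `G` induced on `D`. -/
def eigCountOn (s : Set ℝ) [Finite V] (G : SimpleGraph V) (D : Set V) : ℕ :=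
  eigCount s ((adj G).submatrix (Subtype.val : D → V) Subtype.val)

theorem eigCountOn_union (s : Set ℝ) [Finite V] {D E : Set V} (hd : Disjoint D E)
    (h : ∀ v ∈ D, ∀ w ∈ E, ¬ G.Adj v w) :
    eigCountOn s G (D ∪ E) = eigCountOn s G D + eigCountOn s G E := by
  classical
  unfold eigCountOn
  rw [← eigCount_fromBlocks, ← eigCount_submatrix s (Equiv.Set.union hd).symm]
  congr 1
  ext (i | i) (j | j)
  · simp
  · simpa using adj_eq_zero (h i i.2 j j.2)
  · simpa using adj_eq_zero fun hij => h j j.2 i i.2 hij.symm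
  · simp

theorem below_iff_mem_support (hG : G.IsTree) {r v w : V} {p : G.Walk w r} (hp : p.IsPath) :
    Below G r v w ↔ v ∈ p.support := by
  refine ⟨fun ⟨q, hq, hv⟩ => ?_, fun h => ⟨p, hp, h⟩⟩
  rwa [(hG.existsUnique_path w r).unique hp hq]

theorem length_lt_of_below (hG : G.IsTree) {r v w : V} (h : Below G r v w) (hne : v ≠ w)
    {p : G.Walk v r} {q : G.Walk w r} (hp : p.IsPath) (hq : q.IsPath) : p.length < q.length := by
  classical
  rw [below_iff_mem_support hG hq] at h
  rw [(hG.existsUnique_path v r).unique hp (hq.dropUntil h)]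
  have h1 := congrArg SimpleGraph.Walk.length (q.take_spec h)
  rw [SimpleGraph.Walk.length_append] at h1
  have h2 : 0 < (q.takeUntil v h).length := by
    rw [Nat.pos_iff_ne_zero]
    exact fun h0 => hne (SimpleGraph.Walk.eq_of_length_eq_zero h0).symm
  omega

/-- The length of the path to the root. -/
def depth (hG : G.IsTree) (r v : V) : ℕ := (hG.existsUnique_path v r).choose.length

theorem depth_lt_of_below (hG : G.IsTree) {r v w : V} (h : Below G r v w) (hne : v ≠ w) :
    depth hG r v < depth hG r w :=
  length_lt_of_below hG h hne (hG.existsUnique_path v r).choose_spec.1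
    (hG.existsUnique_path w r).choose_spec.1

/-- Of two adjacent vertices, one is the parent of the other. -/
theorem below_of_adj (hG : G.IsTree) {r v a b : V} (hab : G.Adj a b) (hva : Below G r v a)
    (hvb : ¬ Below G r v b) : v = a ∧ Below G r b a := by
  classical
  obtain ⟨p, hp, hv⟩ := id hva
  have hb : b ∈ p.support := by
    by_contra hb
    exact hvb ⟨.cons hab.symm p, hp.cons hb, by simp [hv]⟩
  have hba : Below G r b a := ⟨p, hp, hb⟩
  obtain ⟨q, hq, -⟩ := hG.existsUnique_path b r
  have ha : a ∉ q.support := fun ha =>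
    absurd (depth_lt_of_below hG hba hab.ne') (not_lt.mpr
      (depth_lt_of_below hG ⟨q, hq, ha⟩ hab.ne).le)
  -- The path from `a` is the edge to `b` followed by the path from `b`. It meets `v`, but its tail
  -- does not, so `v = a`.
  rw [(hG.existsUnique_path a r).unique hp (hq.cons ha : (SimpleGraph.Walk.cons hab q).IsPath),
    SimpleGraph.Walk.support_cons, List.mem_cons] at hv
  refine ⟨hv.resolve_right fun h => hvb ⟨q, hq, h⟩, hba⟩

theorem rootGain_induce (s : Set ℝ) [Finite V] {D : Set V} {v : V} (hv : v ∈ D) :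
    rootGain s (G.induce D) ⟨v, hv⟩ =
      (eigCountOn s G D : ℝ) - eigCountOn s G (D \ {v}) := by
  have h1 : (adj G).submatrix (Subtype.val : D → V) Subtype.val = adj (G.induce D) :=
    adj_submatrix_of_iff _ fun v w => Iff.rfl
  let e : ↥(D \ {v}) ≃ {w : D // w ≠ ⟨v, hv⟩} :=
    { toFun := fun w => ⟨⟨w.1, w.2.1⟩, fun h => w.2.2 (congrArg Subtype.val h)⟩
      invFun := fun w => ⟨w.1.1, w.1.2, fun h => w.2 (Subtype.ext h)⟩
      left_inv := fun _ => rfl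
      right_inv := fun _ => rfl }
  unfold rootGain eigCountOn
  rw [h1, ← eigCount_submatrix s e, ← h1]
  rfl

/-- Induction that removes a vertex `v` of minimal depth in `D`. No other vertex of `D` lies above
`v`, so the subtree `B` below `v` has no edge to `R = D \ B`. The counts on `D` and `D \ {v}` split
along `B` and `R`; the part from `R` cancels, which leaves the gain of `v`. -/
theorem sum_rootGain_of_downward_closed [Fintype V] (s : Set ℝ) (hG : G.IsTree) (r : V)
    (D : Finset V) (hD : ∀ v ∈ D, ∀ w, Below G r v w → w ∈ D) :
    ∑ v ∈ D, rootGain s (G.induce {w | Below G r v w}) ⟨v, below_self hG r v⟩ =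
      eigCountOn s G D := by
  classical
  induction hn : D.card generalizing D with
  | zero =>
    rw [Finset.card_eq_zero] at hn
    subst hn
    rw [Finset.sum_empty, Finset.coe_empty, eigCountOn, eigCount_of_isEmpty, Nat.cast_zero]
  | succ n ih =>
    have hne : D.Nonempty := Finset.card_pos.mp (by omega)
    obtain ⟨v, hv, hmin⟩ := D.exists_min_image (depth hG r) hne
    have hbelow : ∀ u ∈ D, u ≠ v → ¬ Below G r u v := fun u hu huv h =>
      absurd (depth_lt_of_below hG h huv) (not_lt.mpr (hmin u hu))
    have hcard : (D.erase v).card = n := by rw [Finset.card_erase_of_mem hv]; omega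
    rw [← Finset.add_sum_erase _ _ hv, ih (D.erase v) ?_ hcard, rootGain_induce]
    · set B : Set V := {w | Below G r v w}
      set R : Set V := ↑D \ B
      have hBD : B ⊆ D := fun w hw => hD v hv w hw
      have hadj : ∀ a ∈ B, ∀ b ∈ R, ¬ G.Adj a b := by
        intro a ha b hb hab
        obtain ⟨rfl, hba⟩ := below_of_adj hG hab ha hb.2
        exact hbelow b hb.1 hab.ne' hba
      have hdisj : Disjoint B R := Set.disjoint_sdiff_right
      have hvB : v ∈ B := below_self hG r v
      have h1 : (D : Set V) = B ∪ R := (Set.union_sdiff_cancel hBD).symm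
      have h2 : ((D.erase v : Finset V) : Set V) = (B \ {v}) ∪ R := by
        rw [Finset.coe_erase, h1, Set.union_sdiff_distrib, Set.sdiff_singleton_eq_self (a := v)
          (fun h : v ∈ R => h.2 hvB)]
      rw [h2, h1, eigCountOn_union s hdisj hadj, eigCountOn_union s
        (hdisj.mono_left Set.sdiff_subset) fun a ha b hb => hadj a ha.1 b hb]
      push_cast
      ring
    · intro u hu w huw
      rw [Finset.mem_erase] at hu ⊢
      refine ⟨?_, hD u hu.2 w huw⟩
      rintro rfl
      exact hbelow u hu.2 hu.1 huw

/-- The eigenvalues of a tree in `s` are counted by adding up the gains of its vertices. -/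
theorem sum_rootGain [Fintype V] (s : Set ℝ) (hG : G.IsTree) (r : V) :
    ∑ v, rootGain s (G.induce {w | Below G r v w}) ⟨v, below_self hG r v⟩ =
      eigCount s (adj G) := by
  rw [sum_rootGain_of_downward_closed s hG r Finset.univ fun _ _ _ _ => Finset.mem_univ _,
    Finset.coe_univ, eigCountOn, ← eigCount_submatrix s (Equiv.Set.univ V)]
  rfl

end Telescope

/-! ### The spectral distribution as a function of the fringe distribution -/

/-- The gain of the root of an unlabeled tree, extended to `*` as the gain of a single vertex. -/
def treeGain (s : Set ℝ) : TreeStar → ℝ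
  -- Coordinate 0 of a fringe sequence is never `*`; this value keeps the bounds and the limits in
  -- `x` valid on all of `TreeStar`.
  | none => s.indicator 1 0
  | some t => rootGain s t.rep.graph t.rep.root

theorem treeGain_of (s : Set ℝ) {V : Type*} [Fintype V] (G : SimpleGraph V) (hG : G.IsTree)
    (r : V) : treeGain s (some (UnlabeledTree.of G hG r)) = rootGain s G r := by
  obtain ⟨e, he⟩ := Quotient.exact (Quotient.out_eq (UnlabeledTree.of G hG r))
  have h1 := rootGain_congr s e he
  have h2 := rootGain_congr s (SimpleGraph.Iso.comap (Fintype.equivFin V).symm G)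
    (r := Fintype.equivFin V r) (q := r) (by simp)
  exact h1.trans h2

theorem abs_treeGain_le_one {s : Set ℝ} (hs : Convex ℝ s) (hs' : Convex ℝ sᶜ) (t : TreeStar) :
    |treeGain s t| ≤ 1 := by
  cases t with
  | none =>
    by_cases h : (0 : ℝ) ∈ s <;> simp [treeGain, h]
  | some t => exact abs_rootGain_le_one hs hs' _ _

theorem treeGain_disjoint_union {s t : Set ℝ} (h : Disjoint s t) (x : TreeStar) :
    treeGain (s ∪ t) x = treeGain s x + treeGain t x := by
  cases x with
  | none => exact congrFun (Set.indicator_union_of_disjoint h 1) 0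
  | some x => exact rootGain_disjoint_union h _ _

/-- Once `x` exceeds all eigenvalues of both matrices, the gain is the difference of their sizes.
This is what prevents loss of mass at infinity. -/
theorem eventually_treeGain_Iic_eq_one (t : TreeStar) :
    ∀ᶠ x in atTop, treeGain (Set.Iic x) t = 1 := by
  cases t with
  | none =>
    filter_upwards [eventually_ge_atTop 0] with x hx
    simp [treeGain, hx]
  | some t =>
    have hA := isHermitian_adj t.rep.graph
    obtain ⟨M, hM, -⟩ := exists_bound_eigenvalues hA
    obtain ⟨M', hM', -⟩ := exists_bound_eigenvalues
      (hA.submatrix (Subtype.val : {v // v ≠ t.rep.root} → _))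
    filter_upwards [eventually_ge_atTop M, eventually_ge_atTop M'] with x hx hx'
    rw [treeGain, rootGain, hM x hx, hM' x hx']
    have : 0 < t.rep.card := Fin.pos t.rep.root
    simp [Nat.card_eq_fintype_card, Fintype.card_subtype_compl, Nat.cast_sub this]

theorem eventually_treeGain_Iic_eq_zero (t : TreeStar) :
    ∀ᶠ x in atBot, treeGain (Set.Iic x) t = 0 := by
  cases t with
  | none =>
    filter_upwards [eventually_lt_atBot 0] with x hx
    simp [treeGain, hx]
  | some t =>
    have hA := isHermitian_adj t.rep.graph
    obtain ⟨M, -, hM⟩ := exists_bound_eigenvalues hA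
    obtain ⟨M', -, hM'⟩ := exists_bound_eigenvalues
      (hA.submatrix (Subtype.val : {v // v ≠ t.rep.root} → _))
    filter_upwards [eventually_lt_atBot (-M), eventually_lt_atBot (-M')] with x hx hx'
    rw [treeGain, rootGain, hM x hx, hM' x hx']
    simp

theorem integral_empirical {ι α : Type*} [Fintype ι] [Nonempty ι] [MeasurableSpace α]
    (x : ι → α) {f : α → ℝ} (hf : Measurable f) :
    ∫ a, f a ∂(empirical x : Measure α) = (Fintype.card ι : ℝ)⁻¹ * ∑ i, f (x i) := by
  have hi (i) : Integrable f (Measure.dirac (x i)) :=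
    integrable_dirac' hf.stronglyMeasurable (by simp)
  change ∫ a, f a ∂((Fintype.card ι : ℝ≥0∞)⁻¹ • ∑ i, Measure.dirac (x i)) = _
  rw [integral_smul_measure, integral_finsetSum_measure fun i _ => hi i]
  simp [integral_dirac' _ _ hf.stronglyMeasurable]

theorem measureReal_spectralDist (t : UnlabeledTree) {s : Set ℝ} (hs : MeasurableSet s) :
    (spectralDist t : Measure ℝ).real s =
      (t.rep.card : ℝ)⁻¹ * eigCount s (adj t.rep.graph) := by
  classical
  rw [← integral_indicator_one hs, spectralDist,
    integral_empirical _ (measurable_one.indicator hs), Fintype.card_fin,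
    eigCount_eq_card s (isHermitian_adj t.rep.graph), Fintype.card_subtype, Finset.card_filter]
  push_cast
  refine congrArg _ (Finset.sum_congr rfl fun i _ => ?_)
  rw [Set.indicator_apply]
  congr!

theorem treeGain_fringeSeq_zero {V : Type*} [Fintype V] {G : SimpleGraph V} (hG : G.IsTree) (r v : V)
    (s : Set ℝ) : treeGain s (fringeSeq hG r v 0) =
      rootGain s (G.induce {w | Below G r v w}) ⟨v, below_self hG r v⟩ := by
  classical
  rw [fringeSeq, dif_pos (Nat.zero_le _), treeGain_of]
  congr!
  exact ancestor_zero hG r v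

theorem integral_treeGain_fringeDist (t : UnlabeledTree) {s : Set ℝ} (hs : MeasurableSet s) :
    ∫ x, treeGain s (x 0) ∂(fringeDist t : Measure (ℕ → TreeStar)) =
      (spectralDist t : Measure ℝ).real s := by
  have hmeas : Measurable fun x : ℕ → TreeStar => treeGain s (x 0) :=
    (Measurable.of_discrete (f := treeGain s)).comp (measurable_pi_apply 0)
  rw [fringeDist, integral_empirical _ hmeas, measureReal_spectralDist t hs,
    ← sum_rootGain s t.rep.isTree t.rep.root, Fintype.card_fin]
  simp_rw [treeGain_fringeSeq_zero]

/-! ### Convergence to a constant -/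

/-- Convergence in probability to a constant: the probability of lying outside any given
neighborhood of the constant tends to zero. -/
def TendstoInProbConst {Ω : ℕ → Type*} [∀ n, MeasurableSpace (Ω n)] (P : ∀ n, Measure (Ω n))
    {E : Type*} [TopologicalSpace E] (X : ∀ n, Ω n → E) (c : E) : Prop :=
  ∀ U ∈ 𝓝 c, Tendsto (fun n => P n (X n ⁻¹' Uᶜ)) atTop (𝓝 0)

/-- `ψ` need not factor through `φ`: it suffices that `ψ` is near `d` wherever `φ` is near `c`. -/
theorem TendstoInProbConst.comp_of_tendsto_comap {Ω : ℕ → Type*} [∀ n, MeasurableSpace (Ω n)]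
    {P : ∀ n, Measure (Ω n)} {A E F : Type*} [TopologicalSpace E] [TopologicalSpace F] {c : E}
    {T : ∀ n, Ω n → A} {φ : A → E} {ψ : A → F} {d : F}
    (h : TendstoInProbConst P (fun n ω => φ (T n ω)) c)
    (hψ : Tendsto ψ (comap φ (𝓝 c)) (𝓝 d)) :
    TendstoInProbConst P (fun n ω => ψ (T n ω)) d := by
  intro U hU
  obtain ⟨V, hV, hVU⟩ := hψ hU
  refine tendsto_of_tendsto_of_tendsto_of_le_of_le tendsto_const_nhds (h V hV)
    (fun _ => zero_le) fun n => measure_mono fun ω hω hωV => hω (hVU hωV)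

section

variable {Ω : ℕ → Type*} [∀ n, MeasurableSpace (Ω n)] {P : ∀ n, Measure (Ω n)}
  [∀ n, IsProbabilityMeasure (P n)] {E : Type*} [TopologicalSpace E] {X : ∀ n, Ω n → E} {c : E}

theorem TendstoInDistributionConst.tendstoInProbConst [TopologicalSpace.PseudoMetrizableSpace E]
    (h : TendstoInDistributionConst P X c) : TendstoInProbConst P X c := by
  let : MeasurableSpace E := borel E
  have : BorelSpace E := ⟨rfl⟩
  have h' : TendstoInDistribution X atTop (fun _ : Unit => c) P (Measure.dirac ()) := h
  intro U hU
  -- Portmanteau for the closed complement of `interior U`, which is null for the Dirac mass at `c`.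
  have hlim := ProbabilityMeasure.limsup_measure_closed_le_of_tendsto h'.tendsto
    (isOpen_interior (s := U)).isClosed_compl
  have hmeas : MeasurableSet (interior U)ᶜ := isOpen_interior.measurableSet.compl
  have h0 : (Measure.map (fun _ : Unit => c) (Measure.dirac ())) (interior U)ᶜ = 0 := by
    rw [Measure.map_dirac' measurable_const, Measure.dirac_apply' _ hmeas]
    simp [mem_interior_iff_mem_nhds.mpr hU]
  have hle : limsup (fun n => P n (X n ⁻¹' (interior U)ᶜ)) atTop ≤ 0 := by
    rw [← h0]
    refine le_trans (le_of_eq ?_) hlim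
    congr 1
    ext n
    exact (Measure.map_apply_of_aemeasurable (h'.forall_aemeasurable n) hmeas).symm
  have hto : Tendsto (fun n => P n (X n ⁻¹' (interior U)ᶜ)) atTop (𝓝 0) :=
    tendsto_of_le_liminf_of_limsup_le zero_le hle
  exact tendsto_of_tendsto_of_tendsto_of_le_of_le tendsto_const_nhds hto (fun _ => zero_le)
    fun n => measure_mono (Set.preimage_mono (Set.compl_subset_compl.mpr interior_subset))

theorem TendstoInProbConst.tendstoInDistributionConst (h : TendstoInProbConst P X c)
    (hX : ∀ n, Measurable[_, borel E] (X n)) : TendstoInDistributionConst P X c := by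
  let : MeasurableSpace E := borel E
  have : BorelSpace E := ⟨rfl⟩
  refine ⟨fun n => (hX n).aemeasurable, measurable_const.aemeasurable, ?_⟩
  refine ProbabilityMeasure.tendsto_iff_forall_integral_tendsto.mpr fun f => ?_
  have hfm : Measurable f := f.continuous.measurable
  have hlim : ∫ x, f x ∂(Measure.map (fun _ : Unit => c) (Measure.dirac ())) = f c := by
    rw [Measure.map_dirac' measurable_const, integral_dirac' _ _ hfm.stronglyMeasurable]
  have hn (n) : ∫ x, f x ∂(Measure.map (X n) (P n)) = ∫ ω, f (X n ω) ∂P n :=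
    integral_map (hX n).aemeasurable hfm.aestronglyMeasurable
  change Tendsto (fun n => ∫ x, f x ∂(Measure.map (X n) (P n))) atTop
    (𝓝 (∫ x, f x ∂(Measure.map (fun _ : Unit => c) (Measure.dirac ()))))
  simp_rw [hn, hlim]
  rw [Metric.tendsto_atTop]
  intro ε hε
  set U : Set E := {x | |f x - f c| < ε / 2}
  have hUo : IsOpen U := isOpen_lt (by fun_prop) continuous_const
  have hU : U ∈ 𝓝 c := hUo.mem_nhds (by simp [U, hε])
  have hP : Tendsto (fun n => 2 * ‖f‖ * (P n).real (X n ⁻¹' Uᶜ)) atTop (𝓝 0) := by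
    have h0 : Tendsto (fun n => (P n).real (X n ⁻¹' Uᶜ)) atTop (𝓝 0) :=
      (ENNReal.tendsto_toReal ENNReal.zero_ne_top).comp (h U hU)
    simpa only [mul_zero] using h0.const_mul (2 * ‖f‖)
  obtain ⟨N, hN⟩ := eventually_atTop.mp (hP.eventually_lt_const (half_pos hε))
  refine ⟨N, fun n hnN => ?_⟩
  have hB : MeasurableSet (X n ⁻¹' Uᶜ) := hX n hUo.measurableSet.compl
  have hi : Integrable (fun ω => f (X n ω)) (P n) :=
    Integrable.of_bound (hfm.comp (hX n)).aestronglyMeasurable ‖f‖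
      (ae_of_all _ fun ω => f.norm_coe_le_norm _)
  -- On `U` the deviation is below `ε / 2`; off `U` it is at most `2 * ‖f‖`, on an event of
  -- vanishing probability.
  have hbound : ∀ ω, |f (X n ω) - f c| ≤
      ε / 2 + (X n ⁻¹' Uᶜ).indicator (fun _ => 2 * ‖f‖) ω := by
    intro ω
    by_cases hω : X n ω ∈ U
    · have : ω ∉ X n ⁻¹' Uᶜ := fun h => h hω
      rw [Set.indicator_of_notMem this, add_zero]
      exact le_of_lt hω
    · rw [Set.indicator_of_mem (show ω ∈ X n ⁻¹' Uᶜ from hω)]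
      have h1 := f.norm_coe_le_norm (X n ω)
      have h2 := f.norm_coe_le_norm c
      have h3 := norm_sub_le (f (X n ω)) (f c)
      rw [Real.norm_eq_abs] at h3
      linarith
  have hsub : ∫ ω, f (X n ω) ∂P n - f c = ∫ ω, (f (X n ω) - f c) ∂P n := by
    rw [integral_sub hi (integrable_const _)]
    simp
  rw [Real.dist_eq, hsub]
  calc |∫ ω, (f (X n ω) - f c) ∂P n| ≤ ∫ ω, |f (X n ω) - f c| ∂P n := abs_integral_le_integral_abs
    _ ≤ ∫ ω, (ε / 2 + (X n ⁻¹' Uᶜ).indicator (fun _ => 2 * ‖f‖) ω) ∂P n :=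
        integral_mono (hi.sub (integrable_const _)).abs
          ((integrable_const _).add ((integrable_const _).indicator hB)) hbound
    _ = ε / 2 + 2 * ‖f‖ * (P n).real (X n ⁻¹' Uᶜ) := by
        rw [integral_add (integrable_const _) ((integrable_const _).indicator hB),
          integral_indicator_const _ hB]
        simp [mul_comm]
    _ < ε := by linarith [hN n hnN]

theorem TendstoInProbConst.tendstoInDistributionConst_comp {F : Type*} [TopologicalSpace F]
    {T : ∀ n, Ω n → UnlabeledTree} (hT : ∀ n, Measurable (T n)) {φ : UnlabeledTree → E}
    (h : TendstoInProbConst P (fun n ω => φ (T n ω)) c) {ψ : UnlabeledTree → F} {d : F}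
    (hψ : Tendsto ψ (comap φ (𝓝 c)) (𝓝 d)) :
    TendstoInDistributionConst P (fun n ω => ψ (T n ω)) d := by
  refine (h.comp_of_tendsto_comap hψ).tendstoInDistributionConst fun n => ?_
  let : MeasurableSpace F := borel F
  exact (Measurable.of_discrete (f := ψ)).comp (hT n)

theorem TendstoInProbConst.exists_mem (h : TendstoInProbConst P X c) {U V : Set E}
    (hU : U ∈ 𝓝 c) {d : E} (h' : TendstoInProbConst P X d) (hV : V ∈ 𝓝 d) :
    ∃ n ω, X n ω ∈ U ∩ V := by
  -- Eventually the two exceptional events have total probability below 1, so they cannot cover the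
  -- space.
  have := ((h U hU).add (h' V hV)).eventually_lt_const (u := 1) (by simp)
  obtain ⟨n, hn⟩ := this.exists
  by_contra! hcon
  have huniv : (Set.univ : Set (Ω n)) ⊆ X n ⁻¹' Uᶜ ∪ X n ⁻¹' Vᶜ := fun ω _ => by
    by_cases hω : X n ω ∈ U
    · exact Or.inr fun hv => hcon n ω ⟨hω, hv⟩
    · exact Or.inl hω
  have := (measure_mono huniv).trans (measure_union_le (μ := P n) _ _)
  rw [measure_univ] at this
  exact absurd hn (not_lt.mpr this)

theorem TendstoInProbConst.unique [T2Space E] {d : E} (h : TendstoInProbConst P X c)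
    (h' : TendstoInProbConst P X d) : c = d := by
  by_contra hne
  obtain ⟨U, V, hU, hV, hUV⟩ := t2_separation_nhds hne
  obtain ⟨n, ω, hω⟩ := h.exists_mem hU h' hV
  exact Set.disjoint_left.mp hUV hω.1 hω.2

theorem TendstoInProbConst.comap_neBot {A : Type*} {T : ∀ n, Ω n → A} {φ : A → E}
    (h : TendstoInProbConst P (fun n ω => φ (T n ω)) c) : (comap φ (𝓝 c)).NeBot := by
  rw [comap_neBot_iff]
  intro U hU
  obtain ⟨n, ω, hω⟩ := h.exists_mem hU h hU
  exact ⟨T n ω, hω.1⟩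

end

/-! ### Weak convergence from convergence of distribution functions -/

/-- Intervals `Set.Ioc a b` with endpoints in the dense set `D` form a π-system that contains
arbitrarily small neighborhoods of every point, and their masses are differences of distribution
functions. -/
theorem tendsto_of_tendsto_measureReal_Iic {ι : Type*} {l : Filter ι} [l.IsCountablyGenerated]
    {μ : ι → ProbabilityMeasure ℝ} {ν : ProbabilityMeasure ℝ} {D : Set ℝ} (hD : Dense D)
    (h : ∀ x ∈ D, Tendsto (fun i => (μ i : Measure ℝ).real (Set.Iic x)) l
      (𝓝 ((ν : Measure ℝ).real (Set.Iic x)))) : Tendsto μ l (𝓝 ν) := by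
  have hIoc (ρ : ProbabilityMeasure ℝ) (a b : ℝ) (hab : a ≤ b) :
      (ρ : Measure ℝ).real (Set.Ioc a b) =
        (ρ : Measure ℝ).real (Set.Iic b) - (ρ : Measure ℝ).real (Set.Iic a) := by
    rw [← Set.Iic_sdiff_Iic, measureReal_sdiff (Set.Iic_subset_Iic.mpr hab) measurableSet_Iic]
  refine IsPiSystem.tendsto_probabilityMeasure_of_tendsto_of_mem
    (S := {s | ∃ a ∈ D, ∃ b ∈ D, a < b ∧ Set.Ioc a b = s}) ?_ ?_ ?_ ?_
  · exact isPiSystem_Ioc_mem D D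
  · rintro _ ⟨a, -, b, -, -, rfl⟩
    exact measurableSet_Ioc
  · intro u hu x hx
    obtain ⟨ε, hε, hball⟩ := Metric.isOpen_iff.mp hu x hx
    obtain ⟨a, ha, ha1, ha2⟩ := hD.exists_between (show x - ε < x by linarith)
    obtain ⟨b, hb, hb1, hb2⟩ := hD.exists_between (show x < x + ε by linarith)
    refine ⟨Set.Ioc a b, ⟨a, ha, b, hb, ha2.trans hb1, rfl⟩, Ioc_mem_nhds ha2 hb1, fun y hy => ?_⟩
    apply hball
    rw [Real.ball_eq_Ioo]
    exact ⟨ha1.trans hy.1, hy.2.trans_lt hb2⟩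
  · rintro _ ⟨a, ha, b, hb, hab, rfl⟩
    rw [← NNReal.tendsto_coe]
    change Tendsto (fun i => (μ i : Measure ℝ).real (Set.Ioc a b)) l
      (𝓝 ((ν : Measure ℝ).real (Set.Ioc a b)))
    simp_rw [hIoc _ a b hab.le]
    exact (h b hb).sub (h a ha)

/-- If the distribution functions converge pointwise, without loss of mass at infinity, then the
probability measures converge weakly. -/
theorem exists_tendsto_of_tendsto_measureReal_Iic {ι : Type*} {l : Filter ι}
    [l.IsCountablyGenerated] [l.NeBot] {μ : ι → ProbabilityMeasure ℝ} {G : ℝ → ℝ}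
    (h : ∀ x, Tendsto (fun i => (μ i : Measure ℝ).real (Set.Iic x)) l (𝓝 (G x)))
    (hbot : Tendsto G atBot (𝓝 0)) (htop : Tendsto G atTop (𝓝 1)) :
    ∃ ν : ProbabilityMeasure ℝ, Tendsto μ l (𝓝 ν) := by
  have hG : Monotone G := fun x y hxy => le_of_tendsto_of_tendsto' (h x) (h y) fun i =>
    measureReal_mono (Set.Iic_subset_Iic.mpr hxy)
  -- `G` need not be right-continuous. Its right-limit version lies between `G x` and `G (x + 1)`,
  -- hence has the same limits at both ends.
  have hle (x) : G x ≤ Function.rightLim G x := hG.le_rightLim le_rfl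
  have hge (x) : Function.rightLim G x ≤ G (x + 1) := hG.rightLim_le (by linarith)
  have hbot' : Tendsto hG.stieltjesFunction atBot (𝓝 0) :=
    tendsto_of_tendsto_of_tendsto_of_le_of_le hbot
      (hbot.comp (tendsto_atBot_add_const_right _ 1 tendsto_id)) hle hge
  have htop' : Tendsto hG.stieltjesFunction atTop (𝓝 1) :=
    tendsto_of_tendsto_of_tendsto_of_le_of_le htop
      (htop.comp (tendsto_atTop_add_const_right _ 1 tendsto_id)) hle hge
  have hprob := hG.stieltjesFunction.isProbabilityMeasure hbot' htop'
  -- A monotone function has countably many discontinuities, so its continuity points are dense;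
  -- there `G` agrees with its right limit.
  refine ⟨⟨hG.stieltjesFunction.measure, hprob⟩, tendsto_of_tendsto_measureReal_Iic
    (D := {x | ¬ ContinuousAt G x}ᶜ) (hG.countable_not_continuousAt.dense_compl ℝ) ?_⟩
  intro x hx
  have hx' : ContinuousAt G x := not_not.mp hx
  have hval : hG.stieltjesFunction.measure.real (Set.Iic x) = G x := by
    rw [Measure.real, StieltjesFunction.measure_Iic _ hbot', sub_zero,
      Monotone.stieltjesFunction_eq, hx'.continuousWithinAt.rightLim_eq]
    refine ENNReal.toReal_ofReal ?_
    exact ge_of_tendsto' (h x) fun i => measureReal_nonneg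
  change Tendsto _ l (𝓝 (hG.stieltjesFunction.measure.real (Set.Iic x)))
  rw [hval]
  exact h x

/-! ### Convergence of the spectral distributions -/

section

variable (μ : ProbabilityMeasure (ℕ → TreeStar))

theorem measurable_treeGain_zero (s : Set ℝ) :
    Measurable fun x : ℕ → TreeStar => treeGain s (x 0) :=
  (Measurable.of_discrete (f := treeGain s)).comp (measurable_pi_apply 0)

theorem tendsto_spectralDist_real {s : Set ℝ} (hs : MeasurableSet s) {C : ℝ}
    (hC : ∀ t, |treeGain s t| ≤ C) :
    Tendsto (fun t => (spectralDist t : Measure ℝ).real s) (comap fringeDist (𝓝 μ))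
      (𝓝 (∫ x, treeGain s (x 0) ∂(μ : Measure (ℕ → TreeStar)))) := by
  let f : BoundedContinuousFunction (ℕ → TreeStar) ℝ :=
    BoundedContinuousFunction.ofNormedAddCommGroup (fun x => treeGain s (x 0))
      ((continuous_of_discreteTopology (f := treeGain s)).comp (continuous_apply 0)) C
      fun x => hC (x 0)
  have := (ProbabilityMeasure.tendsto_iff_forall_integral_tendsto.mp
    (tendsto_comap (f := fringeDist) (x := 𝓝 μ))) f
  refine this.congr fun t => integral_treeGain_fringeDist t hs

theorem abs_treeGain_Iic_le_one (x : ℝ) (t : TreeStar) : |treeGain (Set.Iic x) t| ≤ 1 :=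
  abs_treeGain_le_one (convex_Iic x) (by rw [Set.compl_Iic]; exact convex_Ioi x) t

/-- Interlacing does not apply directly, as the complement of a point is not convex; the gain of a
point is a difference of gains of two half-lines. -/
theorem abs_treeGain_singleton_le_two (x : ℝ) (t : TreeStar) : |treeGain {x} t| ≤ 2 := by
  have h1 := abs_treeGain_Iic_le_one x t
  have h2 : |treeGain (Set.Iio x) t| ≤ 1 :=
    abs_treeGain_le_one (convex_Iio x) (by rw [Set.compl_Iio]; exact convex_Ici x) t
  rw [← Set.Iio_union_right, treeGain_disjoint_union (by simp)] at h1
  rw [abs_le] at *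
  constructor <;> linarith

theorem tendsto_integral_treeGain_Iic {l : Filter ℝ} [l.IsCountablyGenerated] {c : ℝ}
    (h : ∀ t, ∀ᶠ x in l, treeGain (Set.Iic x) t = c) :
    Tendsto (fun x => ∫ y, treeGain (Set.Iic x) (y 0) ∂(μ : Measure (ℕ → TreeStar))) l (𝓝 c) := by
  have : Tendsto (fun x => ∫ y, treeGain (Set.Iic x) (y 0) ∂(μ : Measure (ℕ → TreeStar))) l
      (𝓝 (∫ _, c ∂(μ : Measure (ℕ → TreeStar)))) :=
    tendsto_integral_filter_of_dominated_convergence (fun _ => 1)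
      (Eventually.of_forall fun x => (measurable_treeGain_zero _).aestronglyMeasurable)
      (Eventually.of_forall fun x => ae_of_all _ fun y => abs_treeGain_Iic_le_one x (y 0))
      (integrable_const _)
      (ae_of_all _ fun y => tendsto_const_nhds.congr' ((h (y 0)).mono fun _ h => h.symm))
  simpa using this

theorem exists_tendsto_spectralDist [(comap fringeDist (𝓝 μ)).NeBot] :
    ∃ F : ProbabilityMeasure ℝ, Tendsto spectralDist (comap fringeDist (𝓝 μ)) (𝓝 F) :=
  exists_tendsto_of_tendsto_measureReal_Iic
    (fun x => tendsto_spectralDist_real μ measurableSet_Iic (abs_treeGain_Iic_le_one x))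
    (tendsto_integral_treeGain_Iic μ eventually_treeGain_Iic_eq_zero)
    (tendsto_integral_treeGain_Iic μ eventually_treeGain_Iic_eq_one)

end

end RandomTree

end

theorem theorem4p3 {Ω : ℕ → Type*} [∀ n, MeasurableSpace (Ω n)]
    (P : ∀ n, Measure (Ω n)) [∀ n, IsProbabilityMeasure (P n)]
    (T : ∀ n, Ω n → RandomTree.UnlabeledTree) (hT : ∀ n, Measurable (T n))
    {Ω' : Type*} [MeasurableSpace Ω'] (P' : Measure Ω') [IsProbabilityMeasure P']
    (S : Ω' → ℕ → RandomTree.UnlabeledTree) (hS : Measurable S)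
    (hconv : RandomTree.ProbabilityFringeConverges P T P' S hS) :
    (∃ F : ProbabilityMeasure ℝ, RandomTree.TendstoInDistributionConst P
        (fun n ω => RandomTree.spectralDist (T n ω)) F) ∧
    ∀ γ : ℝ, ∃ c : ℝ,
      RandomTree.TendstoInDistributionConst P
        (fun n ω => (RandomTree.spectralDist (T n ω) : Measure ℝ).real {γ}) c ∧
      ∀ F : ProbabilityMeasure ℝ,
        RandomTree.TendstoInDistributionConst P
          (fun n ω => RandomTree.spectralDist (T n ω)) F →
        c ≤ (F : Measure ℝ).real {γ} := by
  have hprob := RandomTree.TendstoInDistributionConst.tendstoInProbConst hconv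
  have hne := hprob.comap_neBot
  obtain ⟨F₀, hF₀⟩ := RandomTree.exists_tendsto_spectralDist (RandomTree.sinTreeLaw P' S hS)
  have hspec := hprob.comp_of_tendsto_comap hF₀
  have hγ (γ : ℝ) := RandomTree.tendsto_spectralDist_real (RandomTree.sinTreeLaw P' S hS)
    (measurableSet_singleton γ) (RandomTree.abs_treeGain_singleton_le_two γ)
  refine ⟨⟨F₀, hprob.tendstoInDistributionConst_comp hT hF₀⟩,
    fun γ => ⟨_, hprob.tendstoInDistributionConst_comp hT (hγ γ), fun F hF => ?_⟩⟩
  -- Limits in probability are unique in a Hausdorff space, so only `F₀` needs to be treated.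
  obtain rfl := hspec.unique hF.tendstoInProbConst
  have hlim := ProbabilityMeasure.limsup_measure_closed_le_of_tendsto hF₀
    (isClosed_singleton (x := γ))
  have hγ' := (ENNReal.tendsto_ofReal (hγ γ)).congr fun t => ofReal_measureReal
  -- The mass at `γ` converges along the filter, so the portmanteau limsup is its limit `c`.
  rw [hγ'.limsup_eq] at hlim
  exact (ENNReal.ofReal_le_iff_le_toReal (measure_ne_top _ _)).mp hlim
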